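/- Let $\mathcal H$ be a real or complex Hilbert space and let $T$ be a linear operator in $\mathcal H$, defined on a linear subspace $\operatorname{dom}T$ (not assumed dense or closed), that is positive: $\langle Tf,g\rangle=\langle f,Tg\rangle$ and $\langle Tf,f\rangle\ge 0$ for all $f,g\in\operatorname{dom}T$. Assume that $T$ has at least one positive self-adjoint extension. Let $\mathcal E_T$ be the completion of $\operatorname{ran}T$ in the inner product $\langle Tf,Th\rangle_{\mathcal E}:=\langle Tf,h\rangle$ $(f,h\in\operatorname{dom}T)$, let $J_T:\mathcal E_T\to\mathcal H$ be the densely defined operator with domain $\operatorname{ran}T\subseteq\mathcal E_T$ given by $J_T(Th):=Th$, and put $T_N:=J_T^{**}J_T^{*}$. For positive self-adjoint operators $S_1,S_2$ in $\mathcal H$ write $S_1\preceq S_2$ (form order) if $(I+S_2)^{-1}\le (I+S_1)^{-1}$. Put $$\mathcal D_*(T):=\Bigl\{g\in\mathcal H:\ \sup\{|\langle Th,g\rangle|^2 : h\in\operatorname{dom}T,\ \langle Th,h\rangle\le 1\}<\infty\Bigr\}.$$ Then $T_N$ is the smallest positive self-adjoint extension of $T$ in the form order: $T_N$ is positive and self-adjoint,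 $T\subseteq T_N$, and $T_N\preceq S$ for every positive self-adjoint extension $S$ of $T$. Moreover, $T_N$ has a positive self-adjoint square root, and every such square root $T_N^{1/2}$ satisfies $\operatorname{dom}T_N^{1/2}=\mathcal D_*(T)$ and $$\|T_N^{1/2}g\|^2=\sup\{|\langle g,Th\rangle|^2 : h\in\operatorname{dom}T,\ \langle Th,h\rangle\le 1\},\qquad g\in\mathcal D_*(T).$$ -/

import Mathlib

open scoped LinearPMap

noncomputable section

namespace KreinNeumann

/-- The composition `g ∘ f` of two partially defined operators on its natural (maximal) domain
`{x ∈ dom f | f x ∈ dom g}`. -/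
def natComp {𝕜 E F G : Type*} [Ring 𝕜] [AddCommGroup E] [Module 𝕜 E]
    [AddCommGroup F] [Module 𝕜 F] [AddCommGroup G] [Module 𝕜 G]
    (g : F →ₗ.[𝕜] G) (f : E →ₗ.[𝕜] F) : E →ₗ.[𝕜] G :=
  g.comp (f.domRestrict ((g.domain.comap f.toFun).map f.domain.subtype)) (by
    rintro ⟨x, hx, hxf⟩
    obtain ⟨y, hy, rfl⟩ := Submodule.mem_map.1 hx
    exact hy)

theorem mem_natComp_graph {𝕜 E F G : Type*} [Ring 𝕜] [AddCommGroup E] [Module 𝕜 E]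
    [AddCommGroup F] [Module 𝕜 F] [AddCommGroup G] [Module 𝕜 G]
    (g : F →ₗ.[𝕜] G) (f : E →ₗ.[𝕜] F) (x : E) (z : G) :
    (x, z) ∈ (natComp g f).graph ↔ ∃ y, (x, y) ∈ f.graph ∧ (y, z) ∈ g.graph := by
  simp only [LinearPMap.mem_graph_iff]
  constructor
  · rintro ⟨⟨x', hx, hxf⟩, rfl, rfl⟩
    obtain ⟨y, hy, rfl⟩ := Submodule.mem_map.1 hx
    exact ⟨f y, ⟨y, rfl, rfl⟩, ⟨⟨f y, hy⟩, rfl, rfl⟩⟩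
  · rintro ⟨y, ⟨a, rfl, rfl⟩, ⟨b, hb, rfl⟩⟩
    have hfa : f a ∈ g.domain := hb ▸ b.2
    refine ⟨⟨a, ⟨Submodule.mem_map.2 ⟨a, hfa, rfl⟩, a.2⟩⟩, rfl, ?_⟩
    obtain rfl : b = ⟨f a, hfa⟩ := Subtype.ext hb
    rfl

section Positive

variable {𝕜 H : Type*} [RCLike 𝕜] [NormedAddCommGroup H] [InnerProductSpace 𝕜 H]

/-- A (not necessarily densely defined) operator in `H` is positive if it is symmetric and its
quadratic form is non-negative. -/
structure IsPositive (T : H →ₗ.[𝕜] H) : Prop where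
  symm : ∀ f g : T.domain, inner 𝕜 (T f) (g : H) = inner 𝕜 (f : H) (T g)
  nonneg : ∀ f : T.domain, 0 ≤ RCLike.re (inner 𝕜 (T f) (f : H))

/-- A positive self-adjoint operator. (`IsSelfAdjoint` entails that the domain is dense.) -/
structure IsPositiveSelfAdjoint [CompleteSpace H] (S : H →ₗ.[𝕜] H) : Prop where
  positive : IsPositive S
  selfAdjoint : IsSelfAdjoint S

/-- `R` is a positive self-adjoint square root of `A`: `R` is positive and self-adjoint and
`R ∘ R = A`, equality of domains included. -/
structure IsPositiveSqrt [CompleteSpace H] (A R : H →ₗ.[𝕜] H) : Prop where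
  positiveSelfAdjoint : IsPositiveSelfAdjoint R
  sq_eq : natComp R R = A

/-- The bounded, everywhere defined operator `B` is the inverse `(I + S)⁻¹` of
`I + S : dom S → H`. -/
structure IsShiftedInverse (S : H →ₗ.[𝕜] H) (B : H →L[𝕜] H) : Prop where
  right_inv : ∀ x : H, ∃ hx : B x ∈ S.domain, B x + S ⟨B x, hx⟩ = x
  left_inv : ∀ y : S.domain, B ((y : H) + S y) = y

/-- The form order `S₁ ≼ S₂` of positive self-adjoint operators: `(I + S₂)⁻¹ ≤ (I + S₁)⁻¹` as
bounded operators. The order of `H →L[𝕜] H` is the one given by the quadratic forms. -/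
def FormLE (S₁ S₂ : H →ₗ.[𝕜] H) : Prop :=
  ∃ B₁ B₂ : H →L[𝕜] H, IsShiftedInverse S₁ B₁ ∧ IsShiftedInverse S₂ B₂ ∧ B₂ ≤ B₁

/-- The values `|⟨T h, g⟩|²`, where `h` runs through `dom T` with `⟨T h, h⟩ ≤ 1`. -/
def energyValues (T : H →ₗ.[𝕜] H) (g : H) : Set ℝ :=
  {r | ∃ h : T.domain, RCLike.re (inner 𝕜 (T h) (h : H)) ≤ 1 ∧ r = ‖inner 𝕜 (T h) g‖ ^ 2}

/-- The set `D_*(T)` of all `g` with `sup {|⟨T h, g⟩|² : h ∈ dom T, ⟨T h, h⟩ ≤ 1} < ∞`. -/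
def starDomain (T : H →ₗ.[𝕜] H) : Set H :=
  {g | BddAbove (energyValues T g)}

/-! ### The energy space -/

/-- The range of `T`, as a vector space that is to carry the energy inner product instead of the
inner product of `H`. -/
@[nolint unusedArguments]
def EnergyRange (T : H →ₗ.[𝕜] H) (_hT : IsPositive T) : Type _ := LinearMap.range T.toFun

variable {T : H →ₗ.[𝕜] H} (hT : IsPositive T)

instance : AddCommGroup (EnergyRange T hT) :=
  inferInstanceAs (AddCommGroup (LinearMap.range T.toFun))

instance : Module 𝕜 (EnergyRange T hT) :=
  inferInstanceAs (Module 𝕜 (LinearMap.range T.toFun))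

/-- The inclusion `ran T → H`, `T h ↦ T h`. -/
def energyIncl : EnergyRange T hT →ₗ[𝕜] H := (LinearMap.range T.toFun).subtype

/-- `h ↦ T h`, as a map onto the range of `T`. -/
def energyMk : T.domain →ₗ[𝕜] EnergyRange T hT := T.toFun.rangeRestrict

theorem energyIncl_mk (h : T.domain) : energyIncl hT (energyMk hT h) = T h := rfl

theorem energyMk_surjective : Function.Surjective (energyMk hT) :=
  T.toFun.surjective_rangeRestrict

/-- The energy inner product `⟨T f, T h⟩ := ⟨T f, h⟩` on `ran T`; by `energyInner_mk` it does not
depend on the choice of `h`. -/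
def energyInner (y z : EnergyRange T hT) : 𝕜 :=
  inner 𝕜 (energyIncl hT y) ((Function.surjInv (energyMk_surjective hT) z : T.domain) : H)

theorem energyInner_mk (f h : T.domain) :
    energyInner hT (energyMk hT f) (energyMk hT h) = inner 𝕜 (T f) (h : H) := by
  set k := Function.surjInv (energyMk_surjective hT) (energyMk hT h) with hk
  have h1 : T k = T h :=
    congrArg (energyIncl hT) (Function.surjInv_eq (energyMk_surjective hT) (energyMk hT h))
  change inner 𝕜 (T f) (k : H) = _
  rw [hT.symm, hT.symm, h1]

/-- The energy inner product is a positive semidefinite Hermitian form on `ran T`. -/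
instance energyCore : PreInnerProductSpace.Core 𝕜 (EnergyRange T hT) where
  inner := energyInner hT
  conj_inner_symm x y := by
    obtain ⟨f, rfl⟩ := energyMk_surjective hT x
    obtain ⟨g, rfl⟩ := energyMk_surjective hT y
    rw [energyInner_mk, energyInner_mk, inner_conj_symm, hT.symm]
  re_inner_nonneg x := by
    obtain ⟨f, rfl⟩ := energyMk_surjective hT x
    rw [energyInner_mk]
    exact hT.nonneg f
  add_left x y z := by
    simp only [energyInner, map_add, inner_add_left]
  smul_left x y r := by
    simp only [energyInner, map_smul, inner_smul_left]

instance : SeminormedAddCommGroup (EnergyRange T hT) :=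
  InnerProductSpace.Core.toSeminormedAddCommGroup (𝕜 := 𝕜)

instance : InnerProductSpace 𝕜 (EnergyRange T hT) :=
  InnerProductSpace.ofCore (energyCore hT)

theorem inner_energyMk (f h : T.domain) :
    inner 𝕜 (energyMk hT f) (energyMk hT h) = inner 𝕜 (T f) (h : H) :=
  energyInner_mk hT f h

/-- The energy space of `T`: the (Hausdorff) completion of `ran T` in the energy inner product. -/
abbrev EnergySpace (T : H →ₗ.[𝕜] H) (hT : IsPositive T) : Type _ :=
  UniformSpace.Completion (EnergyRange T hT)

/-- The operator `J_T` from the energy space to `H`, with domain the copy of `ran T` in the energy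
space, `J_T (T h) = T h`. It is given by its graph. That this is a graph is proved in
`mem_energyEmbedding_graph` whenever `T` has a positive self-adjoint extension. -/
def energyEmbedding : EnergySpace T hT →ₗ.[𝕜] H :=
  Submodule.toLinearPMap (LinearMap.range
    ((UniformSpace.Completion.toComplₗᵢ (𝕜 := 𝕜) (E := EnergyRange T hT)).toLinearMap.prod
      (energyIncl hT)))

/-- If `T` has a positive (self-adjoint) extension, a vector `h` with `⟨T h, h⟩ = 0` satisfies
`T h = 0`: the energy inner product is definite. -/
theorem apply_eq_zero_of_inner_eq_zero [CompleteSpace H]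
    (hext : ∃ S : H →ₗ.[𝕜] H, IsPositiveSelfAdjoint S ∧ T ≤ S) (h : T.domain)
    (h0 : RCLike.re (inner 𝕜 (T h) (h : H)) = 0) : T h = 0 := by
  obtain ⟨S, hS, hTS⟩ := hext
  set h' : S.domain := ⟨h, hTS.1 h.2⟩ with hh'
  have hTh : T h = S h' := hTS.2 rfl
  rw [hTh] at h0 ⊢
  refine hS.selfAdjoint.dense_domain.eq_zero_of_inner_left 𝕜 fun v hv => ?_
  have hcs := norm_inner_le_norm (𝕜 := 𝕜) (energyMk hS.positive h')
    (energyMk hS.positive ⟨v, hv⟩)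
  have hn : ‖energyMk hS.positive h'‖ = 0 := by
    have h1 := inner_self_eq_norm_sq (𝕜 := 𝕜) (energyMk hS.positive h')
    rw [inner_energyMk] at h1
    have h2 : ‖energyMk hS.positive h'‖ ^ 2 = 0 := by rw [← h1]; exact h0
    simpa using h2
  rw [hn, zero_mul, inner_energyMk] at hcs
  exact norm_le_zero_iff.1 hcs

theorem mem_energyEmbedding_graph [CompleteSpace H]
    (hext : ∃ S : H →ₗ.[𝕜] H, IsPositiveSelfAdjoint S ∧ T ≤ S) (x : EnergySpace T hT) (y : H) :
    (x, y) ∈ (energyEmbedding hT).graph ↔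
      ∃ h : T.domain, x = (energyMk hT h : EnergySpace T hT) ∧ y = T h := by
  rw [energyEmbedding, Submodule.toLinearPMap_graph_eq]
  · constructor
    · rintro ⟨z, hz⟩
      obtain ⟨h, rfl⟩ := energyMk_surjective hT z
      exact ⟨h, (congrArg Prod.fst hz).symm, (congrArg Prod.snd hz).symm⟩
    · rintro ⟨h, rfl, rfl⟩
      exact ⟨energyMk hT h, rfl⟩
  · rintro _ ⟨z, rfl⟩ hz
    obtain ⟨h, rfl⟩ := energyMk_surjective hT z
    change ((energyMk hT h : EnergyRange T hT) : EnergySpace T hT) = 0 at hz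
    change T h = 0
    refine apply_eq_zero_of_inner_eq_zero hext h ?_
    rw [← inner_energyMk hT, inner_self_eq_norm_sq, ← UniformSpace.Completion.norm_coe, hz]
    simp

/-- The Krein-von Neumann operator `T_N = J_T** J_T*`. -/
def kreinNeumann [CompleteSpace H] : H →ₗ.[𝕜] H :=
  natComp (energyEmbedding hT)†† (energyEmbedding hT)†

end Positive

end KreinNeumann

end

/-! Everything is read off from `J_T*`. A vector `g` lies in its domain iff `Th ↦ ⟨Th, g⟩` is
bounded in the energy norm. By homogeneity this means `g ∈ D_*(T)`, and the supremum is then `‖J_T*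
g‖²` (`isLUB_energyValues`).

For a positive self-adjoint `S ⊇ T`, Cauchy–Schwarz for the form of `S` gives `|⟨Th, z⟩|² ≤ ⟨Th,
h⟩⟨Sz, z⟩`. Hence `dom S ⊆ dom J_T*` and `‖J_T* z‖² ≤ ⟨Sz, z⟩`. So `J_T*` is closed and densely
defined, and `T_N = (J_T*)* J_T*` is positive self-adjoint by von Neumann's theorem. The same
inequality, after completing squares, compares the resolvents (`kreinNeumann_formLE`).

A self-adjoint root `R` satisfies `R* R = T_N`. As `dom T_N` is a core of both `R` and `J_T*`, these
have equal domains and norms (`exists_mem_graph_norm_eq`). A root exists as a quotient of bounded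
roots, which come from a power series. -/

namespace KreinNeumann

/-! ### Von Neumann's theorem on `A* A`, and cores, through graphs. -/

section Graph

variable {𝕜 H E : Type*} [RCLike 𝕜] [NormedAddCommGroup H] [InnerProductSpace 𝕜 H]
  [NormedAddCommGroup E] [InnerProductSpace 𝕜 E]

theorem mem_adjoint_graph_iff [CompleteSpace H] {A : H →ₗ.[𝕜] E}
    (hA : Dense (A.domain : Set H)) {y : E} {w : H} :
    (y, w) ∈ A†.graph ↔ ∀ x z, (x, z) ∈ A.graph → inner 𝕜 z y = inner 𝕜 x w := by
  rw [LinearPMap.adjoint_graph_eq_graph_adjoint hA, Submodule.mem_adjoint_iff]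
  simp only [sub_eq_zero]

/-- The graph of `A`, as a subspace of the Hilbert space direct sum. -/
noncomputable def hilbertGraph (A : H →ₗ.[𝕜] E) : Submodule 𝕜 (WithLp 2 (H × E)) :=
  A.graph.comap (WithLp.linearEquiv 2 𝕜 (H × E)).toLinearMap

theorem mem_hilbertGraph {A : H →ₗ.[𝕜] E} {x : WithLp 2 (H × E)} :
    x ∈ hilbertGraph A ↔ (x.fst, x.snd) ∈ A.graph := Iff.rfl

theorem isClosed_hilbertGraph {A : H →ₗ.[𝕜] E} (hA : A.IsClosed) :
    IsClosed (hilbertGraph A : Set (WithLp 2 (H × E))) :=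
  IsClosed.preimage (WithLp.prod_continuous_ofLp 2 H E) hA

theorem hasOrthogonalProjection_hilbertGraph [CompleteSpace H] [CompleteSpace E]
    {A : H →ₗ.[𝕜] E} (hA : A.IsClosed) : (hilbertGraph A).HasOrthogonalProjection := by
  have := (isClosed_hilbertGraph hA).completeSpace_coe
  infer_instance

/-- For a closed densely defined operator `A`, the operator `I + A† A` is surjective. -/
theorem exists_mem_graph_mem_adjoint_graph [CompleteSpace H] [CompleteSpace E] {A : H →ₗ.[𝕜] E}
    (hd : Dense (A.domain : Set H)) (hA : A.IsClosed) (x : H) :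
    ∃ y z, (y, z) ∈ A.graph ∧ (z, x - y) ∈ A†.graph := by
  have := hasOrthogonalProjection_hilbertGraph hA
  -- Splitting `(x, 0)` along the graph gives `p = (y, Ay)` and `q = (x - y, -Ay)`; that `q` is
  -- orthogonal to the graph says `A† A y = x - y`.
  obtain ⟨p, hp, q, hq, hpq⟩ :=
    (hilbertGraph A).exists_add_mem_mem_orthogonal (WithLp.toLp 2 (x, (0 : E)))
  have h1 : x = p.fst + q.fst := congrArg WithLp.fst hpq
  have h2 : 0 = p.snd + q.snd := congrArg WithLp.snd hpq
  refine ⟨p.fst, p.snd, hp, (mem_adjoint_graph_iff hd).2 fun u v huv => ?_⟩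
  have h3 := (Submodule.mem_orthogonal _ _).1 hq (WithLp.toLp 2 (u, v)) huv
  rw [WithLp.prod_inner_apply] at h3
  change inner 𝕜 u q.fst + inner 𝕜 v q.snd = 0 at h3
  rw [show q.fst = x - p.fst by rw [h1]; abel, eq_neg_of_add_eq_zero_right h2.symm,
    inner_neg_right] at h3
  linear_combination -h3

theorem mem_natComp_adjoint_graph [CompleteSpace H] {A : H →ₗ.[𝕜] E} {x y : H} :
    (x, y) ∈ (natComp A† A).graph ↔ ∃ z, (x, z) ∈ A.graph ∧ (z, y) ∈ A†.graph :=
  mem_natComp_graph _ _ _ _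

theorem isPositive_of_graph {N : H →ₗ.[𝕜] H}
    (hs : ∀ x y u v, (x, y) ∈ N.graph → (u, v) ∈ N.graph → inner 𝕜 y u = inner 𝕜 x v)
    (hp : ∀ x y, (x, y) ∈ N.graph → 0 ≤ RCLike.re (inner 𝕜 y x)) : IsPositive N :=
  ⟨fun f g => hs _ _ _ _ (N.mem_graph f) (N.mem_graph g), fun f => hp _ _ (N.mem_graph f)⟩

theorem IsPositive.inner_graph {N : H →ₗ.[𝕜] H} (hN : IsPositive N) {x y u v : H}
    (h : (x, y) ∈ N.graph) (h' : (u, v) ∈ N.graph) : inner 𝕜 y u = inner 𝕜 x v := by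
  obtain ⟨a, rfl, rfl⟩ := (N.mem_graph_iff).1 h
  obtain ⟨b, rfl, rfl⟩ := (N.mem_graph_iff).1 h'
  exact hN.symm a b

theorem IsPositive.re_inner_graph {N : H →ₗ.[𝕜] H} (hN : IsPositive N) {x y : H}
    (h : (x, y) ∈ N.graph) : 0 ≤ RCLike.re (inner 𝕜 y x) := by
  obtain ⟨a, rfl, rfl⟩ := (N.mem_graph_iff).1 h
  exact hN.nonneg a

/-- `I + N` is bounded below by one. -/
theorem IsPositive.norm_sq_le {N : H →ₗ.[𝕜] H} (hN : IsPositive N) {x y : H}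
    (h : (x, y) ∈ N.graph) : ‖x‖ ^ 2 ≤ RCLike.re (inner 𝕜 (x + y) x) := by
  rw [inner_add_left, map_add, inner_self_eq_norm_sq]
  linarith [hN.re_inner_graph h]

theorem isPositive_natComp_adjoint [CompleteSpace H] {A : H →ₗ.[𝕜] E}
    (hd : Dense (A.domain : Set H)) : IsPositive (natComp A† A) := by
  refine isPositive_of_graph (fun x y u v h h' => ?_) fun x y h => ?_
  · obtain ⟨a, ha, ha'⟩ := mem_natComp_adjoint_graph.1 h
    obtain ⟨b, hb, hb'⟩ := mem_natComp_adjoint_graph.1 h'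
    rw [← (mem_adjoint_graph_iff hd).1 hb' _ _ ha, ← inner_conj_symm,
      ← (mem_adjoint_graph_iff hd).1 ha' _ _ hb, inner_conj_symm]
  · obtain ⟨a, ha, ha'⟩ := mem_natComp_adjoint_graph.1 h
    rw [inner_re_symm, ← (mem_adjoint_graph_iff hd).1 ha' _ _ ha, inner_self_eq_norm_sq]
    positivity

theorem natComp_adjoint_surjective [CompleteSpace H] [CompleteSpace E] {A : H →ₗ.[𝕜] E}
    (hd : Dense (A.domain : Set H)) (hA : A.IsClosed) (x : H) :
    ∃ y, (y, x - y) ∈ (natComp A† A).graph := by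
  obtain ⟨y, z, h, h'⟩ := exists_mem_graph_mem_adjoint_graph hd hA x
  exact ⟨y, mem_natComp_adjoint_graph.2 ⟨z, h, h'⟩⟩

theorem norm_sq_eq_of_mem_natComp [CompleteSpace H] {A : H →ₗ.[𝕜] E}
    (hd : Dense (A.domain : Set H)) {x y : H} {z : E} (h : (x, y) ∈ (natComp A† A).graph)
    (hz : (x, z) ∈ A.graph) : ‖z‖ ^ 2 = RCLike.re (inner 𝕜 x y) := by
  obtain ⟨a, ha, ha'⟩ := mem_natComp_adjoint_graph.1 h
  obtain rfl := LinearPMap.mem_graph_snd_inj _ ha hz rfl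
  rw [← (mem_adjoint_graph_iff hd).1 ha' _ _ ha, inner_self_eq_norm_sq]

/-- A positive operator `N` with `I + N` surjective is self-adjoint. -/
theorem IsPositive.isPositiveSelfAdjoint [CompleteSpace H] {N : H →ₗ.[𝕜] H} (hN : IsPositive N)
    (hsurj : ∀ x, ∃ y, (y, x - y) ∈ N.graph) : IsPositiveSelfAdjoint N := by
  have hd : Dense (N.domain : Set H) := by
    rw [Submodule.dense_iff_topologicalClosure_eq_top,
      Submodule.topologicalClosure_eq_top_iff, Submodule.eq_bot_iff]
    intro x hx
    -- If `x ⊥ dom N` and `x = y + Ny`, then `‖y‖² ≤ re ⟨x, y⟩ = 0`, so `x = 0`.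
    obtain ⟨y, hy⟩ := hsurj x
    have h1 := hN.norm_sq_le hy
    rw [add_sub_cancel, (Submodule.mem_orthogonal' _ _).1 hx y
      (LinearPMap.mem_domain_of_mem_graph hy), map_zero] at h1
    have h2 : y = 0 := by simpa using le_antisymm h1 (sq_nonneg _)
    subst h2
    simpa using LinearPMap.graph_fst_eq_zero_snd _ hy rfl
  refine ⟨hN, ?_⟩
  rw [LinearPMap.isSelfAdjoint_def]
  refine LinearPMap.eq_of_eq_graph (le_antisymm ?_ ?_)
  · rintro ⟨y, w⟩ h
    -- For `w = N† y`, solve `u + Nu = y + w`. Pairing with an arbitrary `v = x + Nx` gives `⟨v, y⟩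
    -- = ⟨x, y + w⟩ = ⟨v, u⟩`.
    obtain ⟨u, hu⟩ := hsurj (y + w)
    have h1 : ∀ v : H, inner 𝕜 v y = inner 𝕜 v u := fun v => by
      obtain ⟨x, hx⟩ := hsurj v
      have e1 := (mem_adjoint_graph_iff hd).1 h _ _ hx
      have e2 := hN.inner_graph hx hu
      simp only [inner_sub_left, inner_sub_right, inner_add_right] at e1 e2
      linear_combination e1 - e2
    obtain rfl : y = u := ext_inner_left 𝕜 h1
    simpa using hu
  · rintro ⟨y, w⟩ h
    exact (mem_adjoint_graph_iff hd).2 fun x z hx => hN.inner_graph hx h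

/-- Injectivity of `I + N`, from its lower bound applied to a difference. -/
theorem IsPositive.eq_of_add_eq {N : H →ₗ.[𝕜] H} (hN : IsPositive N) {x y u v : H}
    (h : (x, y) ∈ N.graph) (h' : (u, v) ∈ N.graph) (e : x + y = u + v) : x = u := by
  have h1 := hN.norm_sq_le (N.graph.sub_mem h h')
  rw [show (x - u) + (y - v) = 0 by rw [sub_add_sub_comm, e, sub_self], inner_zero_left,
    map_zero] at h1
  have h2 : x - u = 0 := by simpa using le_antisymm h1 (sq_nonneg _)
  exact sub_eq_zero.1 h2

/-- The inverse of `I + N` exists as a bounded operator. -/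
theorem IsPositive.exists_shiftedInverse {N : H →ₗ.[𝕜] H}
    (hN : IsPositive N) (hsurj : ∀ x, ∃ y, (y, x - y) ∈ N.graph) :
    ∃ B : H →L[𝕜] H, IsShiftedInverse N B ∧ ∀ x, (B x, x - B x) ∈ N.graph := by
  choose b hb using hsurj
  let B₀ : H →ₗ[𝕜] H :=
    { toFun := b
      map_add' := fun x y => hN.eq_of_add_eq (hb _) (N.graph.add_mem (hb x) (hb y)) (by
        change b (x + y) + (x + y - b (x + y)) = b x + b y + ((x - b x) + (y - b y))
        abel)
      map_smul' := fun c x => hN.eq_of_add_eq (hb _) (N.graph.smul_mem c (hb x)) (by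
        simp [smul_sub]) }
  have hB : ∀ x, ‖B₀ x‖ ≤ 1 * ‖x‖ := fun x => by
    have h1 := hN.norm_sq_le (hb x)
    rw [add_sub_cancel] at h1
    have h2 := h1.trans ((RCLike.re_le_norm _).trans (norm_inner_le_norm _ _))
    rw [one_mul]
    change ‖b x‖ ≤ ‖x‖
    by_contra! hlt
    nlinarith [norm_nonneg x]
  refine ⟨B₀.mkContinuous 1 hB, ⟨fun x => ?_, fun y => ?_⟩, hb⟩
  · have hx := LinearPMap.mem_domain_of_mem_graph (hb x)
    refine ⟨hx, ?_⟩
    have := LinearPMap.mem_graph_snd_inj _ (N.mem_graph ⟨b x, hx⟩) (hb x) rfl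
    change b x + N ⟨b x, hx⟩ = x
    rw [this, add_sub_cancel]
  · exact hN.eq_of_add_eq (hb _) (N.mem_graph y) (add_sub_cancel _ _)

theorem IsPositive.inner_shiftedInverse {N : H →ₗ.[𝕜] H} (hN : IsPositive N) {B : H →L[𝕜] H}
    (hB : ∀ x, (B x, x - B x) ∈ N.graph) (x y : H) : inner 𝕜 (B x) y = inner 𝕜 x (B y) := by
  have h := hN.inner_graph (hB x) (hB y)
  rw [inner_sub_left, inner_sub_right] at h
  linear_combination -h

/-- The domain of `A† A` is a core of the closed operator `A`. -/
theorem hilbertGraph_le_closure [CompleteSpace H] [CompleteSpace E] {A : H →ₗ.[𝕜] E}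
    (hd : Dense (A.domain : Set H)) (hA : A.IsClosed) :
    hilbertGraph A ≤ (hilbertGraph (A.domRestrict (natComp A† A).domain)).topologicalClosure := by
  have := hasOrthogonalProjection_hilbertGraph hA
  rw [← Submodule.orthogonal_orthogonal_eq_closure]
  intro v hv
  refine (Submodule.mem_orthogonal _ _).2 fun w hw => ?_
  obtain ⟨p, hp, q, hq, rfl⟩ := (hilbertGraph A).exists_add_mem_mem_orthogonal w
  -- With `y + A† A y = p.fst`, orthogonality to `(y, Ay)` reads `0 = ⟨p.fst, y + A† A y⟩ =
  -- ‖p.fst‖²`. So `p = 0`, and `w` is orthogonal to the whole graph.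
  obtain ⟨y, hy⟩ := natComp_adjoint_surjective hd hA p.fst
  obtain ⟨z, hz, hz'⟩ := mem_natComp_adjoint_graph.1 hy
  have hyz : WithLp.toLp 2 (y, z) ∈ hilbertGraph (A.domRestrict (natComp A† A).domain) := by
    have hyA := LinearPMap.mem_domain_of_mem_graph hz
    refine mem_hilbertGraph.2 ((LinearPMap.mem_graph_iff _).2
      ⟨⟨y, LinearPMap.mem_domain_of_mem_graph hy, hyA⟩, rfl, ?_⟩)
    exact LinearPMap.mem_graph_snd_inj _ (A.mem_graph ⟨y, hyA⟩) hz rfl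
  have h1 := (Submodule.mem_orthogonal' _ _).1 hw _ hyz
  have h2 := (Submodule.mem_orthogonal' _ _).1 hq (WithLp.toLp 2 (y, z)) hz
  rw [inner_add_left, h2, add_zero, WithLp.prod_inner_apply] at h1
  change inner 𝕜 p.fst y + inner 𝕜 p.snd z = 0 at h1
  rw [(mem_adjoint_graph_iff hd).1 hz' _ _ (mem_hilbertGraph.1 hp), ← inner_add_right,
    add_sub_cancel, inner_self_eq_zero] at h1
  have h3 := mem_hilbertGraph.1 hp
  have h4 : p.snd = 0 := LinearPMap.graph_fst_eq_zero_snd _ h3 h1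
  have h5 : p = 0 := WithLp.ofLp_injective 2 (Prod.ext h1 h4)
  rw [h5, zero_add]
  exact (Submodule.mem_orthogonal' _ _).1 hq _ hv

/-- Closed operators `A` and `R` with `A† A = R† R` have the same domain and the same norms. -/
theorem exists_mem_graph_norm_eq [CompleteSpace H] [CompleteSpace E] {F : Type*}
    [NormedAddCommGroup F] [InnerProductSpace 𝕜 F] [CompleteSpace F]
    {A : H →ₗ.[𝕜] E} {R : H →ₗ.[𝕜] F}
    (hd : Dense (A.domain : Set H)) (hA : A.IsClosed) (hdR : Dense (R.domain : Set H))
    (hR : R.IsClosed) (e : natComp A† A = natComp R† R) {x : H} {a : E}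
    (h : (x, a) ∈ A.graph) : ∃ r, (x, r) ∈ R.graph ∧ ‖r‖ = ‖a‖ := by
  have h1 := hilbertGraph_le_closure hd hA (show WithLp.toLp 2 (x, a) ∈ _ from h)
  obtain ⟨s, hs, hlim⟩ := mem_closure_iff_seq_limit.1 h1
  have hN : ∀ n, ∃ y, ((s n).fst, y) ∈ (natComp A† A).graph := fun n =>
    LinearPMap.mem_domain_iff.1 (LinearPMap.mem_domain_of_mem_graph (hs n)).1
  have hAs : ∀ n, ((s n).fst, (s n).snd) ∈ A.graph := fun n =>
    LinearPMap.le_graph_of_le A.domRestrict_le (hs n)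
  choose y hy using hN
  have hRr : ∀ n, ∃ r, ((s n).fst, r) ∈ R.graph := fun n => by
    obtain ⟨r, hr, -⟩ := mem_natComp_adjoint_graph.1 (e ▸ hy n)
    exact ⟨r, hr⟩
  choose r hr using hRr
  have hfst : Filter.Tendsto (fun n => (s n).fst) Filter.atTop (nhds x) :=
    ((continuous_fst.comp (WithLp.prod_continuous_ofLp 2 H E)).tendsto _).comp hlim
  have hsnd : Filter.Tendsto (fun n => (s n).snd) Filter.atTop (nhds a) :=
    ((continuous_snd.comp (WithLp.prod_continuous_ofLp 2 H E)).tendsto _).comp hlim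
  have hnorm : ∀ (u v : H) (b : E) (c : F), (u, v) ∈ (natComp A† A).graph → (u, b) ∈ A.graph →
      (u, c) ∈ R.graph → ‖c‖ = ‖b‖ := fun u v b c h1 h2 h3 => by
    have e1 := norm_sq_eq_of_mem_natComp hd h1 h2
    have e2 := norm_sq_eq_of_mem_natComp hdR (e ▸ h1) h3
    exact (sq_eq_sq₀ (norm_nonneg _) (norm_nonneg _)).1 (e2.trans e1.symm)
  -- `hnorm` applied to differences makes `R` isometric to `A` on the core, so convergence of the
  -- `A`-values makes the `R`-values Cauchy.
  have hcau : CauchySeq r := by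
    have hc := hsnd.cauchySeq
    rw [Metric.cauchySeq_iff] at hc ⊢
    intro ε hε
    obtain ⟨n₀, h₀⟩ := hc ε hε
    refine ⟨n₀, fun m hm n hn => ?_⟩
    rw [dist_eq_norm, hnorm _ _ _ _ (Submodule.sub_mem _ (hy m) (hy n))
      (Submodule.sub_mem _ (hAs m) (hAs n)) (Submodule.sub_mem _ (hr m) (hr n)), ← dist_eq_norm]
    exact h₀ m hm n hn
  obtain ⟨r₀, hr₀⟩ := cauchySeq_tendsto_of_complete hcau
  refine ⟨r₀, hR.mem_of_tendsto (hfst.prodMk_nhds hr₀) (Filter.Eventually.of_forall hr), ?_⟩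
  refine tendsto_nhds_unique hr₀.norm ?_
  rw [funext fun n => hnorm _ _ _ _ (hy n) (hAs n) (hr n)]
  exact hsnd.norm

end Graph

/-! ### The power series of `1 - √(1 - x)` in a Banach algebra. -/

section BinomialSeries

/-- The coefficients of `1 - √(1 - x) = ∑ cₙ xⁿ⁺¹`. -/
noncomputable def sqrtCoeff (n : ℕ) : ℝ := catalan n / (2 * 4 ^ n)

theorem sqrtCoeff_nonneg (n : ℕ) : 0 ≤ sqrtCoeff n := by
  unfold sqrtCoeff
  positivity

/-- The coefficients are the successive differences of `centralBinom n / 4 ^ n`. The resulting bound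
1 gives absolute convergence up to the boundary `‖X‖ = 1`. -/
theorem sum_range_sqrtCoeff (n : ℕ) :
    ∑ i ∈ Finset.range n, sqrtCoeff i = 1 - n.centralBinom / 4 ^ n := by
  induction n with
  | zero => simp
  | succ n ih =>
    rw [Finset.sum_range_succ, ih, sqrtCoeff]
    have h1 : ((n : ℝ) + 1) * catalan n = n.centralBinom := by
      exact_mod_cast succ_mul_catalan_eq_centralBinom n
    have h2 : ((n : ℝ) + 1) * (n + 1).centralBinom = 2 * (2 * n + 1) * n.centralBinom := by
      exact_mod_cast Nat.succ_mul_centralBinom_succ n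
    have h3 : ((n + 1).centralBinom : ℝ) = 2 * (2 * n + 1) * catalan n := by
      have h4 : ((n : ℝ) + 1) ≠ 0 := by positivity
      apply mul_left_cancel₀ h4
      rw [h2, ← h1]
      ring
    rw [h3, ← h1, pow_succ]
    field_simp
    ring

theorem sum_range_sqrtCoeff_le_one (n : ℕ) : ∑ i ∈ Finset.range n, sqrtCoeff i ≤ 1 := by
  rw [sum_range_sqrtCoeff]
  have : (0 : ℝ) ≤ n.centralBinom / 4 ^ n := by positivity
  linarith

theorem summable_sqrtCoeff : Summable sqrtCoeff :=
  summable_of_sum_range_le sqrtCoeff_nonneg sum_range_sqrtCoeff_le_one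

theorem tsum_sqrtCoeff_le_one : ∑' n, sqrtCoeff n ≤ 1 :=
  Real.tsum_le_of_sum_range_le sqrtCoeff_nonneg sum_range_sqrtCoeff_le_one

/-- The Catalan recurrence; it is the coefficient form of `f² = 2f - x` for `f = 1 - √(1 - x)`. -/
theorem sum_antidiagonal_sqrtCoeff (n : ℕ) :
    ∑ p ∈ Finset.HasAntidiagonal.antidiagonal n, sqrtCoeff p.1 * sqrtCoeff p.2 = 2 * sqrtCoeff (n + 1) := by
  have h : ∀ p ∈ Finset.HasAntidiagonal.antidiagonal n, sqrtCoeff p.1 * sqrtCoeff p.2 =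
      ((catalan p.1 * catalan p.2 : ℕ) : ℝ) / (4 * 4 ^ n) := fun p hp => by
    rw [← Finset.HasAntidiagonal.mem_antidiagonal.1 hp, sqrtCoeff, sqrtCoeff, pow_add]
    push_cast
    ring
  rw [Finset.sum_congr rfl h, ← Finset.sum_div, ← Nat.cast_sum, ← catalan_succ', sqrtCoeff,
    pow_succ]
  field_simp

theorem sqrtCoeff_zero : sqrtCoeff 0 = 1 / 2 := by simp [sqrtCoeff]

variable (𝕜 : Type*) {𝔸 : Type*} [RCLike 𝕜] [NormedRing 𝔸] [NormedAlgebra 𝕜 𝔸]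

/-- The value at `X` of the power series of `1 - √(1 - x)`. -/
noncomputable def sqrtSeries (X : 𝔸) : 𝔸 := ∑' n, ((sqrtCoeff n : ℝ) : 𝕜) • X ^ (n + 1)

theorem norm_sqrtSeries_term_le {X : 𝔸} (hX : ‖X‖ ≤ 1) (n : ℕ) :
    ‖((sqrtCoeff n : ℝ) : 𝕜) • X ^ (n + 1)‖ ≤ sqrtCoeff n := by
  rw [norm_smul, RCLike.norm_ofReal, abs_of_nonneg (sqrtCoeff_nonneg n)]
  refine mul_le_of_le_one_right (sqrtCoeff_nonneg n) ?_
  exact (norm_pow_le' X n.succ_pos).trans (pow_le_one₀ (norm_nonneg _) hX)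

theorem summable_norm_sqrtSeries {X : 𝔸} (hX : ‖X‖ ≤ 1) :
    Summable fun n => ‖((sqrtCoeff n : ℝ) : 𝕜) • X ^ (n + 1)‖ :=
  summable_sqrtCoeff.of_nonneg_of_le (fun _ => norm_nonneg _) (norm_sqrtSeries_term_le 𝕜 hX)

theorem norm_sqrtSeries_le {X : 𝔸} (hX : ‖X‖ ≤ 1) : ‖sqrtSeries 𝕜 X‖ ≤ 1 :=
  (tsum_of_norm_bounded summable_sqrtCoeff.hasSum (norm_sqrtSeries_term_le 𝕜 hX)).trans
    tsum_sqrtCoeff_le_one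

variable [CompleteSpace 𝔸]

theorem hasSum_sqrtSeries {X : 𝔸} (hX : ‖X‖ ≤ 1) :
    HasSum (fun n => ((sqrtCoeff n : ℝ) : 𝕜) • X ^ (n + 1)) (sqrtSeries 𝕜 X) :=
  (summable_norm_sqrtSeries 𝕜 hX).of_norm.hasSum

theorem sqrtSeries_mul_self {X : 𝔸} (hX : ‖X‖ ≤ 1) :
    sqrtSeries 𝕜 X * sqrtSeries 𝕜 X = (2 : 𝕜) • sqrtSeries 𝕜 X - X := by
  have hs := summable_norm_sqrtSeries 𝕜 hX
  have h1 : ∀ n, ∑ p ∈ Finset.HasAntidiagonal.antidiagonal n, (((sqrtCoeff p.1 : ℝ) : 𝕜) • X ^ (p.1 + 1)) *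
      (((sqrtCoeff p.2 : ℝ) : 𝕜) • X ^ (p.2 + 1)) =
      (2 : 𝕜) • (((sqrtCoeff (n + 1) : ℝ) : 𝕜) • X ^ (n + 1 + 1)) := fun n => by
    have h2 : ∀ p ∈ Finset.HasAntidiagonal.antidiagonal n, (((sqrtCoeff p.1 : ℝ) : 𝕜) • X ^ (p.1 + 1)) *
        (((sqrtCoeff p.2 : ℝ) : 𝕜) • X ^ (p.2 + 1)) =
        ((sqrtCoeff p.1 * sqrtCoeff p.2 : ℝ) : 𝕜) • X ^ (n + 1 + 1) := fun p hp => by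
      rw [smul_mul_smul_comm, ← pow_add, ← RCLike.ofReal_mul, ← Finset.HasAntidiagonal.mem_antidiagonal.1 hp,
        show p.1 + 1 + (p.2 + 1) = p.1 + p.2 + 1 + 1 by ring]
    rw [Finset.sum_congr rfl h2, ← Finset.sum_smul, ← RCLike.ofReal_sum,
      sum_antidiagonal_sqrtCoeff, smul_smul, RCLike.ofReal_mul, RCLike.ofReal_ofNat]
  rw [sqrtSeries, tsum_mul_tsum_eq_tsum_sum_antidiagonal_of_summable_norm hs hs]
  simp_rw [h1]
  -- The square starts at `X ^ 2`; the missing term of `2f` is `2 c₀ X = X`, which cancels `-X`.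
  rw [hs.of_norm.tsum_eq_zero_add,
    ((summable_nat_add_iff 1).2 hs.of_norm).tsum_const_smul, smul_add, sqrtCoeff_zero, smul_smul,
    RCLike.ofReal_div, RCLike.ofReal_one, RCLike.ofReal_ofNat, mul_one_div_cancel two_ne_zero,
    one_smul, zero_add, pow_one, add_sub_cancel_left]

/-- The square root of `1 - X`. -/
noncomputable def sqrtOneSub (X : 𝔸) : 𝔸 := 1 - sqrtSeries 𝕜 X

theorem sqrtOneSub_mul_self {X : 𝔸} (hX : ‖X‖ ≤ 1) :
    sqrtOneSub 𝕜 X * sqrtOneSub 𝕜 X = 1 - X := by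
  have h : (1 - sqrtSeries 𝕜 X) * (1 - sqrtSeries 𝕜 X) =
      1 - (2 : 𝕜) • sqrtSeries 𝕜 X + sqrtSeries 𝕜 X * sqrtSeries 𝕜 X := by
    rw [two_smul]
    noncomm_ring
  rw [sqrtOneSub, h, sqrtSeries_mul_self 𝕜 hX]
  abel

theorem commute_sqrtOneSub {X Y : 𝔸} (hX : ‖X‖ ≤ 1) (h : Commute Y X) :
    Commute Y (sqrtOneSub 𝕜 X) := by
  refine (Commute.one_right Y).sub_right ?_
  have h1 := (hasSum_sqrtSeries 𝕜 hX).mul_left Y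
  have h2 := (hasSum_sqrtSeries 𝕜 hX).mul_right Y
  refine h1.unique ?_
  convert h2 using 2 with n
  exact ((h.pow_right (n + 1)).smul_right _).eq

end BinomialSeries

/-! ### Square roots of bounded positive contractions. -/

section BoundedSqrt

variable {𝕜 H : Type*} [RCLike 𝕜] [NormedAddCommGroup H] [InnerProductSpace 𝕜 H]

theorem norm_one_sub_le_one {C : H →L[𝕜] H} (hC : C.IsPositive) (h1 : ‖C‖ ≤ 1) : ‖1 - C‖ ≤ 1 := by
  refine ContinuousLinearMap.opNorm_le_bound _ zero_le_one fun x => ?_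
  -- This is `C² ≤ C`: expand `⟨C(x - Cx), x - Cx⟩ ≥ 0` and bound `⟨C(Cx), Cx⟩` by `‖Cx‖²`.
  have hcs : ‖C x‖ ^ 2 ≤ RCLike.re (inner 𝕜 (C x) x) := by
    have e1 := hC.re_inner_nonneg_left (x - C x)
    have e2 := C.le_of_opNorm_le h1 (C x)
    have e3 : RCLike.re (inner 𝕜 (C (C x)) (C x)) ≤ ‖C (C x)‖ * ‖C x‖ := re_inner_le_norm _ _
    rw [map_sub, inner_sub_left, inner_sub_right, inner_sub_right, map_sub, map_sub, map_sub,
      hC.inner_left_eq_inner_right (C x) x, inner_self_eq_norm_sq] at e1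
    nlinarith [norm_nonneg (C x)]
  rw [one_mul, ← sq_le_sq₀ (norm_nonneg _) (norm_nonneg _)]
  change ‖x - C x‖ ^ 2 ≤ _
  rw [norm_sub_sq (𝕜 := 𝕜), inner_re_symm]
  have := hC.re_inner_nonneg_left x
  linarith

variable [CompleteSpace H]

theorem isSelfAdjoint_sqrtSeries {X : H →L[𝕜] H} (hX : ‖X‖ ≤ 1) (hs : IsSelfAdjoint X) :
    IsSelfAdjoint (sqrtSeries 𝕜 X) := by
  refine (hasSum_sqrtSeries 𝕜 hX).star.unique ?_
  convert hasSum_sqrtSeries 𝕜 hX using 2 with n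
  rw [star_smul, star_pow, hs.star_eq, RCLike.star_def, RCLike.conj_ofReal]

/-- Positivity needs only that the series is self-adjoint of norm at most 1. -/
theorem isPositive_sqrtOneSub {X : H →L[𝕜] H} (hX : ‖X‖ ≤ 1) (hs : IsSelfAdjoint X) :
    (sqrtOneSub 𝕜 X).IsPositive := by
  have hsym : ∀ x y, inner 𝕜 (sqrtSeries 𝕜 X x) y = inner 𝕜 x (sqrtSeries 𝕜 X y) :=
    (isSelfAdjoint_sqrtSeries hX hs).isSymmetric
  refine ⟨fun x y => ?_, fun x => ?_⟩
  · change inner 𝕜 (x - sqrtSeries 𝕜 X x) y = inner 𝕜 x (y - sqrtSeries 𝕜 X y)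
    rw [inner_sub_left, inner_sub_right, hsym]
  · change 0 ≤ RCLike.re (inner 𝕜 (x - sqrtSeries 𝕜 X x) x)
    rw [inner_sub_left, map_sub, inner_self_eq_norm_sq]
    have h1 : RCLike.re (inner 𝕜 (sqrtSeries 𝕜 X x) x) ≤ ‖sqrtSeries 𝕜 X x‖ * ‖x‖ :=
      re_inner_le_norm _ _
    have h2 := (sqrtSeries 𝕜 X).le_of_opNorm_le (norm_sqrtSeries_le 𝕜 hX) x
    nlinarith [norm_nonneg x]

/-- The positive square root of a positive contraction. -/
theorem exists_sqrt_of_isPositive {B : H →L[𝕜] H} (hB : B.IsPositive) (h1 : ‖B‖ ≤ 1) :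
    ∃ C : H →L[𝕜] H, C.IsPositive ∧ ‖C‖ ≤ 1 ∧ C * C = B ∧ ∀ Y, Commute Y B → Commute Y C := by
  have hX := norm_one_sub_le_one hB h1
  have hs : IsSelfAdjoint (1 - B) := (IsSelfAdjoint.one _).sub hB.isSelfAdjoint
  have hsq := sqrtOneSub_mul_self 𝕜 hX
  rw [sub_sub_cancel] at hsq
  have hp := isPositive_sqrtOneSub hX hs
  refine ⟨sqrtOneSub 𝕜 (1 - B), hp, ?_, hsq, fun Y hY =>
    commute_sqrtOneSub 𝕜 hX ((Commute.one_right Y).sub_right hY)⟩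
  refine ContinuousLinearMap.opNorm_le_bound _ zero_le_one fun x => ?_
  rw [one_mul, ← sq_le_sq₀ (norm_nonneg _) (norm_nonneg _), ← inner_self_eq_norm_sq (𝕜 := 𝕜),
    ← hp.inner_left_eq_inner_right, ← mul_apply_eq_comp, hsq]
  have h2 := B.le_of_opNorm_le h1 x
  have h3 : RCLike.re (inner 𝕜 (B x) x) ≤ ‖B x‖ * ‖x‖ := re_inner_le_norm _ _
  nlinarith [norm_nonneg x]

/-- Write `C = F²`. Since `D` commutes with `F` too, `⟨Dx, Cx⟩ = ⟨D(Fx), Fx⟩`. -/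
theorem isPositive_mul_of_commute {C D : H →L[𝕜] H} (hC : C.IsPositive) (h1 : ‖C‖ ≤ 1)
    (hD : D.IsPositive) (h : Commute D C) (x : H) : 0 ≤ RCLike.re (inner 𝕜 (D x) (C x)) := by
  obtain ⟨F, hF, -, rfl, hc⟩ := exists_sqrt_of_isPositive hC h1
  rw [mul_apply_eq_comp, ← hF.inner_left_eq_inner_right,
    ← mul_apply_eq_comp, ← (hc D h).eq]
  exact hD.re_inner_nonneg_left (F x)

end BoundedSqrt

/-! ### Square roots of unbounded positive operators. -/

section UnboundedSqrt

variable {𝕜 H : Type*} [RCLike 𝕜] [NormedAddCommGroup H] [InnerProductSpace 𝕜 H]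

/-- The operator `C x ↦ D x`. -/
noncomputable def quotientOp (C D : H →L[𝕜] H) : H →ₗ.[𝕜] H :=
  Submodule.toLinearPMap (LinearMap.range (C.toLinearMap.prod D.toLinearMap))

theorem mem_quotientOp_graph {C D : H →L[𝕜] H} (hC : ∀ x, C x = 0 → x = 0) {y z : H} :
    (y, z) ∈ (quotientOp C D).graph ↔ ∃ x, C x = y ∧ D x = z := by
  rw [quotientOp, Submodule.toLinearPMap_graph_eq]
  · constructor
    · rintro ⟨x, hx⟩
      exact ⟨x, congrArg Prod.fst hx, congrArg Prod.snd hx⟩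
    · rintro ⟨x, rfl, rfl⟩
      exact ⟨x, rfl⟩
  · rintro _ ⟨x, rfl⟩ hx
    change D x = 0
    rw [hC x hx, map_zero]

variable [CompleteSpace H]

/-- A positive operator `N` with `I + N` surjective has a positive self-adjoint square root. -/
theorem IsPositive.exists_isPositiveSqrt {N : H →ₗ.[𝕜] H} (hN : IsPositive N)
    (hsurj : ∀ x, ∃ y, (y, x - y) ∈ N.graph) : ∃ R : H →ₗ.[𝕜] H, IsPositiveSqrt N R := by
  obtain ⟨B, hBN, hB⟩ := hN.exists_shiftedInverse hsurj
  have hBnorm : ∀ x, ‖B x‖ ^ 2 ≤ RCLike.re (inner 𝕜 x (B x)) := fun x => by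
    simpa using hN.norm_sq_le (hB x)
  have hBsymm : ∀ x y, inner 𝕜 (B x) y = inner 𝕜 x (B y) :=
    hN.inner_shiftedInverse hB
  have hBpos : B.IsPositive := ⟨hBsymm, fun x => by
    change 0 ≤ RCLike.re (inner 𝕜 (B x) x)
    rw [hBsymm]
    exact (sq_nonneg _).trans (hBnorm x)⟩
  have hB1 : ‖B‖ ≤ 1 := ContinuousLinearMap.opNorm_le_bound _ zero_le_one fun x => by
    have h1 := (hBnorm x).trans (re_inner_le_norm _ _)
    by_contra! hlt
    nlinarith [norm_nonneg x]
  have hB'pos : (1 - B).IsPositive := by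
    refine ⟨((IsSelfAdjoint.one _).sub hBpos.isSelfAdjoint).isSymmetric, fun x => ?_⟩
    change 0 ≤ RCLike.re (inner 𝕜 (x - B x) x)
    have h1 := B.le_of_opNorm_le hB1 x
    have h2 : RCLike.re (inner 𝕜 (B x) x) ≤ ‖B x‖ * ‖x‖ := re_inner_le_norm _ _
    rw [inner_sub_left, map_sub, inner_self_eq_norm_sq]
    nlinarith [norm_nonneg x]
  -- Here `C² = (I + N)⁻¹` and `D² = N(I + N)⁻¹`, so `C x ↦ D x` is formally `N^{1/2}`, and `C² + D²
  -- = 1`.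
  obtain ⟨C, hC, hC1, hCC, hCc⟩ := exists_sqrt_of_isPositive hBpos hB1
  obtain ⟨D, hD, -, hDD, hDc⟩ := exists_sqrt_of_isPositive hB'pos (norm_one_sub_le_one hBpos hB1)
  have hCB : Commute C B := hCC ▸ (Commute.refl C).mul_right (Commute.refl C)
  have hDC : Commute D C := (hDc C ((Commute.one_right C).sub_right hCB)).symm
  have hDCx : ∀ x, D (C x) = C (D x) := fun x => DFunLike.congr_fun hDC.eq x
  have hCCx : ∀ x, C (C x) = B x := fun x => DFunLike.congr_fun hCC x
  have hDDx : ∀ x, D (D x) = x - B x := fun x => DFunLike.congr_fun hDD x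
  have hC0 : ∀ x, C x = 0 → x = 0 := fun x hx => by
    have h1 : B x = 0 := by rw [← hCCx, hx, map_zero]
    have h2 := hB x
    rw [h1, sub_zero] at h2
    exact LinearPMap.graph_fst_eq_zero_snd _ h2 rfl
  have hCs := hC.inner_left_eq_inner_right
  have hDs := hD.inner_left_eq_inner_right
  -- the inverse of `x ↦ (C x, D x)` on pairs with `D y = C w`
  have key : ∀ y w, D y = C w → C (C y + D w) = y ∧ D (C y + D w) = w := fun y w h => by
    constructor
    · rw [map_add, hCCx, ← hDCx, ← h, hDDx, add_sub_cancel]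
    · rw [map_add, hDCx, h, hCCx, hDDx, add_sub_cancel]
  have hg : ∀ {y z}, (y, z) ∈ (quotientOp C D).graph ↔ ∃ x, C x = y ∧ D x = z :=
    mem_quotientOp_graph hC0
  have hd : Dense ((quotientOp C D).domain : Set H) := by
    rw [Submodule.dense_iff_topologicalClosure_eq_top,
      Submodule.topologicalClosure_eq_top_iff, Submodule.eq_bot_iff]
    intro x hx
    refine hC0 x (ext_inner_left 𝕜 fun v => ?_)
    rw [← hCs, inner_zero_right]
    exact (Submodule.mem_orthogonal _ _).1 hx _
      (LinearPMap.mem_domain_of_mem_graph (hg.2 ⟨v, rfl, rfl⟩))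
  have hpos : IsPositive (quotientOp C D) := by
    refine isPositive_of_graph ?_ ?_
    · intro _ _ _ _ h h'
      obtain ⟨x, rfl, rfl⟩ := hg.1 h
      obtain ⟨y, rfl, rfl⟩ := hg.1 h'
      rw [hDs, hDCx, ← hCs]
    · intro _ _ h
      obtain ⟨x, rfl, rfl⟩ := hg.1 h
      exact isPositive_mul_of_commute hC hC1 hD hDC x
  refine ⟨quotientOp C D, ⟨hpos, ?_⟩, ?_⟩
  · rw [LinearPMap.isSelfAdjoint_def]
    refine LinearPMap.eq_of_eq_graph (le_antisymm ?_ ?_)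
    · rintro ⟨y, w⟩ h
      have h1 : D y = C w := ext_inner_left 𝕜 fun v => by
        rw [← hDs, ← hCs]
        exact (mem_adjoint_graph_iff hd).1 h _ _ (hg.2 ⟨v, rfl, rfl⟩)
      exact hg.2 ⟨_, key y w h1⟩
    · rintro ⟨y, w⟩ h
      exact (mem_adjoint_graph_iff hd).2 fun x z hx => hpos.inner_graph hx h
  · refine LinearPMap.eq_of_eq_graph (Submodule.ext ?_)
    rintro ⟨y, w⟩
    rw [mem_natComp_graph]
    constructor
    · rintro ⟨v, hv, hv'⟩
      obtain ⟨x, rfl, rfl⟩ := hg.1 hv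
      obtain ⟨z, hz, rfl⟩ := hg.1 hv'
      -- With `u = Cx + Dz` one has `x = Cu` and `z = Du`, so the pair is `(C²u, D²u) = (Bu, u -
      -- Bu)`.
      obtain ⟨h1, h2⟩ := key x z hz.symm
      have h3 := hB (C x + D z)
      rw [← hDDx, ← hCCx, h1, h2] at h3
      exact h3
    · intro h
      have hu : B (y + w) = y := hN.eq_of_add_eq (hB _) h (add_sub_cancel _ _)
      refine ⟨D (C (y + w)), hg.2 ⟨C (y + w), by rw [hCCx, hu], rfl⟩,
        hg.2 ⟨D (y + w), (hDCx _).symm, by rw [hDDx, hu, add_sub_cancel_left]⟩⟩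

end UnboundedSqrt

/-! ### The adjoint of `J_T`, and extremality of `T_N`. -/

section Energy

variable {𝕜 H : Type*} [RCLike 𝕜] [NormedAddCommGroup H] [InnerProductSpace 𝕜 H]
  [CompleteSpace H] {T : H →ₗ.[𝕜] H} (hT : IsPositive T)
  (hext : ∃ S : H →ₗ.[𝕜] H, IsPositiveSelfAdjoint S ∧ T ≤ S)

omit [CompleteSpace H] in
theorem norm_sq_energyMk (h : T.domain) :
    ‖(energyMk hT h : EnergySpace T hT)‖ ^ 2 = RCLike.re (inner 𝕜 (T h) (h : H)) := by
  rw [UniformSpace.Completion.norm_coe, ← inner_self_eq_norm_sq (𝕜 := 𝕜), inner_energyMk]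

include hext in
theorem dense_energyEmbedding_domain :
    Dense ((energyEmbedding hT).domain : Set (EnergySpace T hT)) := by
  refine UniformSpace.Completion.denseRange_coe.mono ?_
  rintro _ ⟨y, rfl⟩
  obtain ⟨h, rfl⟩ := energyMk_surjective hT y
  exact LinearPMap.mem_domain_of_mem_graph ((mem_energyEmbedding_graph hT hext _ _).2 ⟨h, rfl, rfl⟩)

include hext in
-- `J_T* g` is the Riesz vector of the pairing of `ran T` with `g`.
theorem mem_energyEmbedding_adjoint_graph {g : H} {a : EnergySpace T hT} :
    (g, a) ∈ (energyEmbedding hT)†.graph ↔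
      ∀ h : T.domain, inner 𝕜 (T h) g = inner 𝕜 (energyMk hT h : EnergySpace T hT) a := by
  rw [mem_adjoint_graph_iff (dense_energyEmbedding_domain hT hext)]
  simp only [mem_energyEmbedding_graph hT hext]
  constructor
  · exact fun H h => H _ _ ⟨h, rfl, rfl⟩
  · rintro H _ _ ⟨h, rfl, rfl⟩
    exact H h

include hext in
/-- A bound for `h ↦ ⟨T h, g⟩` in the energy norm bounds `J_T* g`. -/
theorem norm_sq_le_of_bound {g : H} {a : EnergySpace T hT}
    (hga : (g, a) ∈ (energyEmbedding hT)†.graph) {c : ℝ} (hc : 0 ≤ c)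
    (hb : ∀ h : T.domain,
      ‖inner 𝕜 (T h) g‖ ^ 2 ≤ c * RCLike.re (inner 𝕜 (T h) (h : H))) : ‖a‖ ^ 2 ≤ c := by
  rw [mem_energyEmbedding_adjoint_graph hT hext] at hga
  have h1 : ∀ e : EnergySpace T hT, ‖inner 𝕜 e a‖ ^ 2 ≤ c * ‖e‖ ^ 2 := fun e => by
    induction e using UniformSpace.Completion.induction_on with
    | hp => exact isClosed_le (by fun_prop) (by fun_prop)
    | ih y =>
      obtain ⟨h, rfl⟩ := energyMk_surjective hT y
      rw [← hga, norm_sq_energyMk]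
      exact hb h
  -- By density the bound holds on the whole completion; at `e = a` it reads `‖a‖⁴ ≤ c ‖a‖²`.
  have h2 := h1 a
  rw [inner_self_eq_norm_sq_to_K, norm_pow, RCLike.norm_ofReal, abs_norm] at h2
  by_contra! hlt
  nlinarith

include hext in
theorem exists_mem_energyEmbedding_adjoint_graph {g : H} {c : ℝ} (hc : 0 ≤ c)
    (hb : ∀ h : T.domain,
      ‖inner 𝕜 (T h) g‖ ^ 2 ≤ c * RCLike.re (inner 𝕜 (T h) (h : H))) :
    ∃ a, (g, a) ∈ (energyEmbedding hT)†.graph ∧ ‖a‖ ^ 2 ≤ c := by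
  have hg : g ∈ (energyEmbedding hT)†.domain := by
    rw [LinearPMap.mem_adjoint_domain_iff]
    refine AddMonoidHomClass.continuous_of_bound _ (√c) fun x => ?_
    obtain ⟨h, hx, hJ⟩ := (mem_energyEmbedding_graph hT hext _ _).1
      ((energyEmbedding hT).mem_graph x)
    change ‖inner 𝕜 g (energyEmbedding hT x)‖ ≤ √c * ‖(x : EnergySpace T hT)‖
    rw [hJ, hx, norm_inner_symm]
    refine abs_le_of_sq_le_sq' ?_ (by positivity) |>.2
    rw [mul_pow, Real.sq_sqrt hc, norm_sq_energyMk]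
    exact hb h
  obtain ⟨a, ha⟩ := LinearPMap.mem_domain_iff.1 hg
  exact ⟨a, ha, norm_sq_le_of_bound hT hext ha hc hb⟩

include hT hext in
-- Rescale `h` to energy 1. When `⟨Th, h⟩ = 0` this is impossible, but the existence of an extension
-- then forces `Th = 0`.
theorem norm_sq_inner_le_of_mem_upperBounds {g : H} {b : ℝ}
    (hb : b ∈ upperBounds (energyValues T g)) (h : T.domain) :
    ‖inner 𝕜 (T h) g‖ ^ 2 ≤ b * RCLike.re (inner 𝕜 (T h) (h : H)) := by
  set q := RCLike.re (inner 𝕜 (T h) (h : H)) with hq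
  rcases (hT.nonneg h).eq_or_lt with h0 | h0
  · rw [apply_eq_zero_of_inner_eq_zero hext h h0.symm] at hq ⊢
    simp [hq]
  · have hs : (√q)⁻¹ ^ 2 * q = 1 := by
      rw [inv_pow, Real.sq_sqrt h0.le, inv_mul_cancel₀ h0.ne']
    have h1 := hb ⟨(((√q)⁻¹ : ℝ) : 𝕜) • h, by
      rw [LinearPMap.map_smul, Submodule.coe_smul, inner_smul_left, inner_smul_right,
        RCLike.conj_ofReal, ← mul_assoc, ← RCLike.ofReal_mul, RCLike.re_ofReal_mul, ← sq, ← hq, hs],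
      rfl⟩
    rw [LinearPMap.map_smul, inner_smul_left, RCLike.conj_ofReal, norm_mul, mul_pow,
      RCLike.norm_ofReal, sq_abs] at h1
    calc ‖inner 𝕜 (T h) g‖ ^ 2 = ((√q)⁻¹ ^ 2 * ‖inner 𝕜 (T h) g‖ ^ 2) * q := by
          rw [mul_right_comm, hs, one_mul]
      _ ≤ b * q := by gcongr

omit [CompleteSpace H] in
theorem zero_mem_energyValues (T : H →ₗ.[𝕜] H) (g : H) : 0 ∈ energyValues T g :=
  ⟨0, by simp, by simp⟩

include hext in
theorem isLUB_energyValues {g : H} {a : EnergySpace T hT}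
    (hga : (g, a) ∈ (energyEmbedding hT)†.graph) : IsLUB (energyValues T g) (‖a‖ ^ 2) := by
  constructor
  · rintro _ ⟨h, hh, rfl⟩
    rw [(mem_energyEmbedding_adjoint_graph hT hext).1 hga]
    rw [← norm_sq_energyMk hT] at hh
    calc _ ≤ (‖(energyMk hT h : EnergySpace T hT)‖ * ‖a‖) ^ 2 := by
          gcongr
          exact norm_inner_le_norm _ _
      _ ≤ ‖a‖ ^ 2 := by
          rw [mul_pow]
          exact mul_le_of_le_one_left (sq_nonneg _) hh
  · intro b hb
    exact norm_sq_le_of_bound hT hext hga (hb (zero_mem_energyValues T g))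
      (norm_sq_inner_le_of_mem_upperBounds hT hext hb)

include hext in
theorem mem_energyEmbedding_adjoint_domain_iff {g : H} :
    g ∈ (energyEmbedding hT)†.domain ↔ g ∈ starDomain T := by
  constructor
  · intro hg
    obtain ⟨a, ha⟩ := LinearPMap.mem_domain_iff.1 hg
    exact ⟨_, (isLUB_energyValues hT hext ha).1⟩
  · rintro ⟨b, hb⟩
    obtain ⟨a, ha, -⟩ := exists_mem_energyEmbedding_adjoint_graph hT hext
      (hb (zero_mem_energyValues T g)) (norm_sq_inner_le_of_mem_upperBounds hT hext hb)
    exact LinearPMap.mem_domain_of_mem_graph ha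

/-- `J_T*` is defined on the domain of any positive self-adjoint extension `S` of `T`, with
`‖J_T* z‖² ≤ ⟨S z, z⟩`. -/
theorem exists_mem_energyEmbedding_adjoint_graph_of_le {S : H →ₗ.[𝕜] H}
    (hS : IsPositiveSelfAdjoint S) (hTS : T ≤ S) {z s : H} (hz : (z, s) ∈ S.graph) :
    ∃ a, (z, a) ∈ (energyEmbedding hT)†.graph ∧ ‖a‖ ^ 2 ≤ RCLike.re (inner 𝕜 s z) := by
  obtain ⟨z, rfl, rfl⟩ := S.mem_graph_iff.1 hz
  refine exists_mem_energyEmbedding_adjoint_graph hT ⟨S, hS, hTS⟩ (hS.positive.nonneg z)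
    fun h => ?_
  have h1 : T h = S ⟨h, hTS.1 h.2⟩ := hTS.2 rfl
  -- Cauchy–Schwarz in the energy space of `S`, for the classes of `Sh` and `Sz`.
  rw [h1, ← inner_energyMk hS.positive, ← norm_sq_energyMk hS.positive,
    ← norm_sq_energyMk hS.positive ⟨h, hTS.1 h.2⟩, UniformSpace.Completion.norm_coe,
    UniformSpace.Completion.norm_coe, mul_comm, ← mul_pow]
  gcongr
  exact norm_inner_le_norm _ _

include hext in
theorem dense_energyEmbedding_adjoint_domain :
    Dense ((energyEmbedding hT)†.domain : Set H) := by
  obtain ⟨S, hS, hTS⟩ := hext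
  refine hS.selfAdjoint.dense_domain.mono fun z hz => ?_
  obtain ⟨a, ha, -⟩ := exists_mem_energyEmbedding_adjoint_graph_of_le hT hS hTS
    (S.mem_graph ⟨z, hz⟩)
  exact LinearPMap.mem_domain_of_mem_graph ha

include hext in
theorem isClosed_energyEmbedding_adjoint : (energyEmbedding hT)†.IsClosed :=
  LinearPMap.adjoint_isClosed (dense_energyEmbedding_domain hT hext)

include hext in
theorem isPositive_kreinNeumann : IsPositive (kreinNeumann hT) :=
  isPositive_natComp_adjoint (dense_energyEmbedding_adjoint_domain hT hext)

include hext in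
theorem kreinNeumann_surjective (x : H) : ∃ y, (y, x - y) ∈ (kreinNeumann hT).graph :=
  natComp_adjoint_surjective (dense_energyEmbedding_adjoint_domain hT hext)
    (isClosed_energyEmbedding_adjoint hT hext) x

include hext in
theorem isPositiveSelfAdjoint_kreinNeumann : IsPositiveSelfAdjoint (kreinNeumann hT) :=
  (isPositive_kreinNeumann hT hext).isPositiveSelfAdjoint (kreinNeumann_surjective hT hext)

include hext in
theorem le_kreinNeumann : T ≤ kreinNeumann hT := by
  refine LinearPMap.le_of_le_graph ?_
  rintro ⟨x, y⟩ hxy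
  obtain ⟨h, rfl, rfl⟩ := T.mem_graph_iff.1 hxy
  -- The intermediate vector is the class of `Th`: `J_T* h` is that class because `⟨Tf, h⟩` is the
  -- energy product, and `J_T**` sends it back to `Th`.
  refine mem_natComp_adjoint_graph.2 ⟨(energyMk hT h : EnergySpace T hT), ?_, ?_⟩
  · refine (mem_energyEmbedding_adjoint_graph hT hext).2 fun f => ?_
    rw [UniformSpace.Completion.inner_coe, inner_energyMk]
  · refine (mem_adjoint_graph_iff (dense_energyEmbedding_adjoint_domain hT hext)).2
      fun g a hga => ?_
    rw [← inner_conj_symm, ← (mem_energyEmbedding_adjoint_graph hT hext).1 hga, inner_conj_symm]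

/-- For a positive self-adjoint operator `S`, the operator `I + S` is surjective. -/
theorem IsPositiveSelfAdjoint.surjective {S : H →ₗ.[𝕜] H} (hS : IsPositiveSelfAdjoint S) (x : H) :
    ∃ y, (y, x - y) ∈ S.graph := by
  -- Apply the construction to `S` itself: `S ⊆ S_N` with `S_N` symmetric gives `S_N ⊆ S* = S`, and
  -- `I + S_N` is already known to be surjective.
  have he : ∃ S' : H →ₗ.[𝕜] H, IsPositiveSelfAdjoint S' ∧ S ≤ S' := ⟨S, hS, le_rfl⟩
  have hp := isPositive_kreinNeumann hS.positive he
  have hle := LinearPMap.le_graph_of_le (le_kreinNeumann hS.positive he)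
  obtain ⟨y, hy⟩ := kreinNeumann_surjective hS.positive he x
  refine ⟨y, ?_⟩
  rw [← LinearPMap.isSelfAdjoint_def.1 hS.selfAdjoint]
  exact (mem_adjoint_graph_iff hS.selfAdjoint.dense_domain).2 fun u v huv =>
    hp.inner_graph (hle huv) hy

/-- `T_N` is the smallest positive self-adjoint extension. -/
theorem kreinNeumann_formLE {S : H →ₗ.[𝕜] H} (hS : IsPositiveSelfAdjoint S) (hTS : T ≤ S) :
    FormLE (kreinNeumann hT) S := by
  have hext : ∃ S : H →ₗ.[𝕜] H, IsPositiveSelfAdjoint S ∧ T ≤ S := ⟨S, hS, hTS⟩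
  have hd := dense_energyEmbedding_adjoint_domain hT hext
  have hN := isPositive_kreinNeumann hT hext
  obtain ⟨B₁, hB₁, h₁⟩ := hN.exists_shiftedInverse (kreinNeumann_surjective hT hext)
  obtain ⟨B₂, hB₂, h₂⟩ := hS.positive.exists_shiftedInverse hS.surjective
  refine ⟨B₁, B₂, hB₁, hB₂, ?_⟩
  rw [ContinuousLinearMap.le_def]
  refine ⟨fun x y => ?_, fun x => ?_⟩
  · change inner 𝕜 (B₁ x - B₂ x) y = inner 𝕜 x (B₁ y - B₂ y)
    rw [inner_sub_left, inner_sub_right, hN.inner_shiftedInverse h₁,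
      hS.positive.inner_shiftedInverse h₂]
  change 0 ≤ RCLike.re (inner 𝕜 (B₁ x - B₂ x) x)
  -- With `a = J_T* B₁x` and `b = J_T* B₂x`, the bound on `‖b‖²` yields `re ⟨B₁x - B₂x, x⟩ ≥ ‖B₂x -
  -- B₁x‖² + ‖b - a‖²`.
  obtain ⟨a, ha, ha'⟩ := mem_natComp_adjoint_graph.1 (h₁ x)
  obtain ⟨b, hb, hb'⟩ := exists_mem_energyEmbedding_adjoint_graph_of_le hT hS hTS (h₂ x)
  have e1 := norm_sq_eq_of_mem_natComp hd (h₁ x) ha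
  have e2 := congrArg RCLike.re ((mem_adjoint_graph_iff hd).1 ha' _ _ hb)
  rw [inner_sub_right, map_sub, inner_self_eq_norm_sq, inner_re_symm] at e1
  rw [inner_sub_right, map_sub] at e2
  rw [inner_sub_left, map_sub, inner_self_eq_norm_sq] at hb'
  have e3 := inner_re_symm (𝕜 := 𝕜) x (B₂ x)
  have e4 := inner_re_symm (𝕜 := 𝕜) x (B₁ x)
  have n1 := norm_sub_sq (𝕜 := 𝕜) (B₂ x) (B₁ x)
  have n2 := norm_sub_sq (𝕜 := 𝕜) b a
  rw [inner_sub_left, map_sub]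
  linarith [sq_nonneg ‖B₂ x - B₁ x‖, sq_nonneg ‖b - a‖]

end Energy

end KreinNeumann

theorem mainTheorem2 {𝕜 H : Type*} [RCLike 𝕜] [NormedAddCommGroup H] [InnerProductSpace 𝕜 H]
    [CompleteSpace H] (T : H →ₗ.[𝕜] H) (hT : KreinNeumann.IsPositive T)
    (hext : ∃ S : H →ₗ.[𝕜] H, KreinNeumann.IsPositiveSelfAdjoint S ∧ T ≤ S) :
    -- `T_N` is a positive self-adjoint extension of `T`, and the smallest one
    (KreinNeumann.IsPositiveSelfAdjoint (KreinNeumann.kreinNeumann hT) ∧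
      T ≤ KreinNeumann.kreinNeumann hT ∧
      ∀ S : H →ₗ.[𝕜] H, KreinNeumann.IsPositiveSelfAdjoint S → T ≤ S →
        KreinNeumann.FormLE (KreinNeumann.kreinNeumann hT) S) ∧
    -- the square root of `T_N` exists, and its domain and quadratic form are as claimed
    (∃ R : H →ₗ.[𝕜] H, KreinNeumann.IsPositiveSqrt (KreinNeumann.kreinNeumann hT) R) ∧
    ∀ R : H →ₗ.[𝕜] H, KreinNeumann.IsPositiveSqrt (KreinNeumann.kreinNeumann hT) R →
      (R.domain : Set H) = KreinNeumann.starDomain T ∧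
      ∀ g : R.domain, IsLUB (KreinNeumann.energyValues T (g : H)) (‖R g‖ ^ 2) := by
  refine ⟨⟨KreinNeumann.isPositiveSelfAdjoint_kreinNeumann hT hext,
    KreinNeumann.le_kreinNeumann hT hext, fun S hS hTS =>
      KreinNeumann.kreinNeumann_formLE hT hS hTS⟩,
    (KreinNeumann.isPositive_kreinNeumann hT hext).exists_isPositiveSqrt
      (KreinNeumann.kreinNeumann_surjective hT hext), fun R hR => ?_⟩
  have hsa := hR.positiveSelfAdjoint.selfAdjoint
  have hd := KreinNeumann.dense_energyEmbedding_adjoint_domain hT hext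
  have hc := KreinNeumann.isClosed_energyEmbedding_adjoint hT hext
  -- As `R† = R`, both `R` and `J_T*` are closed factors of `T_N`, so they can be compared in both
  -- directions.
  have he : KreinNeumann.natComp (KreinNeumann.energyEmbedding hT)††
      (KreinNeumann.energyEmbedding hT)† = KreinNeumann.natComp R† R := by
    rw [LinearPMap.isSelfAdjoint_def.1 hsa]
    exact hR.sq_eq.symm
  have hRA : ∀ g : R.domain, ∃ a, ((g : H), a) ∈ (KreinNeumann.energyEmbedding hT)†.graph ∧
      ‖a‖ = ‖R g‖ := fun g =>
    KreinNeumann.exists_mem_graph_norm_eq hsa.dense_domain hsa.isClosed hd hc he.symm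
      (R.mem_graph g)
  refine ⟨Set.ext fun g => ?_, fun g => ?_⟩
  · rw [← KreinNeumann.mem_energyEmbedding_adjoint_domain_iff hT hext]
    constructor
    · intro hg
      obtain ⟨a, ha, -⟩ := hRA ⟨g, hg⟩
      exact LinearPMap.mem_domain_of_mem_graph ha
    · intro hg
      obtain ⟨r, hr, -⟩ := KreinNeumann.exists_mem_graph_norm_eq hd hc hsa.dense_domain
        hsa.isClosed he (LinearPMap.mem_graph _ ⟨g, hg⟩)
      exact LinearPMap.mem_domain_of_mem_graph hr
  · obtain ⟨a, ha, hn⟩ := hRA g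
    rw [← hn]
    exact KreinNeumann.isLUB_energyValues hT hext ha
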